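/- For $n\ge 0$ let $\Pi_n$ be the set of partitions of $[n]=\{1,\dots,n\}$ into disjoint nonempty blocks (so $|\Pi_0|=1$). An edge of $\pi\in\Pi_n$ is a pair $(i,j)$ with $i<j$ such that $i$ and $j$ are consecutive elements of a block of $\pi$. Let $\mathrm{cr}(\pi)$ be the number of crossings of $\pi$, i.e. of pairs of edges $(i_1,j_1),(i_2,j_2)$ with $i_1<i_2<j_1<j_2$, and $\mathrm{ne}(\pi)$ the number of nestings, i.e. of pairs of edges with $i_1<i_2<j_2<j_1$. Let $\mathrm{sg}(\pi)$ be the number of singleton blocks, $\mathrm{bl}(\pi)$ the number of blocks with at least two elements, and $\mathrm{tr}(\pi)$ the number of transients, i.e. of elements that are neither the least nor the greatest element of their block, the block having at least two elements. Let $p,q,u_1,u_2,v$ be elements of a commutative ring $R$ (for instance indeterminates) and put $$B_n(p,q,u_1,u_2,v)=\sum_{\pi\in\Pi_n}p^{\mathrm{cr}(\pi)}q^{\mathrm{ne}(\pi)}u_1^{\mathrm{sg}(\pi)}u_2^{\mathrm{bl}(\pi)}v^{\mathrm{tr}(\pi)},\qquad [k]_{p,q}=\frac{p^k-q^k}{p-q}=\sum_{i=0}^{k-1}p^iq^{k-1-i}.$$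 (If $p-q$ is not invertible, $[k]_{p,q}$ means the sum on the right.) **Proposition.** In $R[[z]]$, the generating function has the continued fraction expansion $$\sum_{n\ge 0}B_n(p,q,u_1,u_2,v)\,z^n=\cfrac{1}{1-u_1z-\cfrac{u_2z^2}{1-(u_1+v)z-\cfrac{u_2[2]_{p,q}z^2}{1-(u_1+[2]_{p,q}v)z-\cfrac{u_2[3]_{p,q}z^2}{\ddots}}}}$$ with partial denominators $1-(u_1+[k]_{p,q}v)z$ and partial numerators $u_2[k+1]_{p,q}z^2$ for $k\ge 0$. That is, for every $n$, the coefficient of $z^n$ in the convergent with $d$ levels (the continued fraction cut off after the denominator $1-(u_1+[d-1]_{p,q}v)z$) equals $B_n(p,q,u_1,u_2,v)$ for all sufficiently large $d$. -/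

import Mathlib

/-- The set partitions of `[n] = {1, …, n}` (blocks are nonempty and pairwise disjoint). -/
abbrev SetPartition (n : ℕ) : Type := Finpartition (Finset.Icc 1 n)

namespace SetPartition

variable {n : ℕ}

/-- The edges `(i, j)` of the partition graph: `i < j` are consecutive elements of a block. -/
def edges (π : SetPartition n) : Finset (ℕ × ℕ) :=
  (Finset.Icc 1 n ×ˢ Finset.Icc 1 n).filter fun e =>
    e.1 < e.2 ∧ ∃ B ∈ π.parts, e.1 ∈ B ∧ e.2 ∈ B ∧ ∀ x ∈ B, ¬(e.1 < x ∧ x < e.2)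

/-- The number of crossings: pairs of edges with `i₁ < i₂ < j₁ < j₂`. -/
def cr (π : SetPartition n) : ℕ :=
  ((π.edges ×ˢ π.edges).filter fun e =>
    e.1.1 < e.2.1 ∧ e.2.1 < e.1.2 ∧ e.1.2 < e.2.2).card

/-- The number of nestings: pairs of edges with `i₁ < i₂ < j₂ < j₁`. -/
def ne (π : SetPartition n) : ℕ :=
  ((π.edges ×ˢ π.edges).filter fun e =>
    e.1.1 < e.2.1 ∧ e.2.1 < e.2.2 ∧ e.2.2 < e.1.2).card

/-- The number of singletons. -/
def sg (π : SetPartition n) : ℕ :=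
  ((Finset.Icc 1 n).filter fun x => {x} ∈ π.parts).card

/-- The number of blocks with at least two elements. -/
def bl (π : SetPartition n) : ℕ :=
  (π.parts.filter fun B => 2 ≤ B.card).card

/-- The number of transients: elements that are neither the least nor the greatest element of
their block, the block having at least two elements. -/
def tr (π : SetPartition n) : ℕ :=
  ((Finset.Icc 1 n).filter fun x =>
    ∃ B ∈ π.parts, 2 ≤ B.card ∧ x ∈ B ∧ (∃ y ∈ B, y < x) ∧ (∃ y ∈ B, x < y)).card

end SetPartition

/-- The enumerating polynomial `B_n(p, q, u₁, u₂, v)` of the set partitions of `[n]`, with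
arguments in a commutative ring (possibly indeterminates). -/
def bellPoly {R : Type*} [CommRing R] (p q u₁ u₂ v : R) (n : ℕ) : R :=
  ∑ π : SetPartition n, p ^ π.cr * q ^ π.ne * u₁ ^ π.sg * u₂ ^ π.bl * v ^ π.tr

/-- `[k]_{p,q} = (p ^ k - q ^ k) / (p - q)`, expanded as the homogeneous polynomial
`p ^ (k - 1) + p ^ (k - 2) * q + ⋯ + q ^ (k - 1)`, so that it makes sense in every commutative
ring; in the sum `k - 1 - i` never truncates because `i < k`. -/
def pqNumber {R : Type*} [CommRing R] (p q : R) (k : ℕ) : R :=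
  ∑ i ∈ Finset.range k, p ^ i * q ^ (k - 1 - i)

theorem pqNumber_mul_sub {R : Type*} [CommRing R] (p q : R) (k : ℕ) :
    pqNumber p q k * (p - q) = p ^ k - q ^ k :=
  (Commute.all p q).geom_sum₂_mul k

theorem pqNumber_eq_div {K : Type*} [Field K] (p q : K) (h : p ≠ q) (k : ℕ) :
    pqNumber p q k = (p ^ k - q ^ k) / (p - q) :=
  eq_div_of_mul_eq (sub_ne_zero.mpr h) (pqNumber_mul_sub p q k)

/-- `jFractionAux b c d m` is the finite continued fraction with `d` levels, starting at level `m`: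
`1 / (1 - b m z - c m z² / (1 - b (m+1) z - c (m+1) z² / (⋯ / (1 - b (m+d-1) z))))`
as a formal power series in `z`. Each denominator has constant coefficient `1`, so that
`PowerSeries.invOfUnit _ 1` is its inverse, see `denominator_mul_jFractionAux`. -/
noncomputable def jFractionAux {R : Type*} [CommRing R] (b c : ℕ → R) : ℕ → ℕ → PowerSeries R
  | 0, _ => 0
  | d + 1, m =>
      PowerSeries.invOfUnit
        (1 - PowerSeries.C (b m) * PowerSeries.X
          - PowerSeries.C (c m) * PowerSeries.X ^ 2 * jFractionAux b c d (m + 1)) 1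

theorem denominator_mul_jFractionAux {R : Type*} [CommRing R] (b c : ℕ → R) (d m : ℕ) :
    (1 - PowerSeries.C (b m) * PowerSeries.X
      - PowerSeries.C (c m) * PowerSeries.X ^ 2 * jFractionAux b c d (m + 1))
      * jFractionAux b c (d + 1) m = 1 := by
  rw [jFractionAux]
  exact PowerSeries.mul_invOfUnit _ 1 (by simp)

/-- The `d`-th convergent of the infinite J-fraction
`1 / (1 - b 0 z - c 0 z² / (1 - b 1 z - c 1 z² / (1 - b 2 z - ⋯)))`. -/
noncomputable def jFractionConvergent {R : Type*} [CommRing R] (b c : ℕ → R) (d : ℕ) :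
    PowerSeries R :=
  jFractionAux b c d 0

/-- The formal power series `F` is the value of the infinite J-fraction with denominators
`1 - b k z` and numerators `c k z²`: its convergents converge to `F` as formal power series, that
is, every coefficient is eventually equal to that of `F`. -/
def HasJFraction {R : Type*} [CommRing R] (F : PowerSeries R) (b c : ℕ → R) : Prop :=
  ∀ n : ℕ, ∀ᶠ d in Filter.atTop,
    PowerSeries.coeff n (jFractionConvergent b c d) = PowerSeries.coeff n F

/-! Read a partition from left to right and regard some of its blocks as still open: an open block
ends in a half-arc at its current greatest element. When `n + 1` is added, it is a singleton (factor
`u₁`), opens a block (factor 1), or is joined to the last point `a` of one of the `k` open blocks,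
either closing that block (factor `u₂`) or leaving it open (factor `v`). The new arc from `a`
crosses the half-arcs to the right of `a` and is nested in those to the left. Choosing `a` among the
`k` open points therefore contributes `∑ p^i q^(k-1-i) = [k]_{p,q}`
(`sum_pow_card_gt_mul_pow_card_lt`).

For this to be exact, a crossing or nesting of a half-arc with a complete arc is counted before the
half-arc is completed (`cr_close`, `ne_close`). The sums over partitions with `k` open blocks then
satisfy the recurrence of weighted Motzkin paths ending at height `k` (`openBellPoly_succ`), and
such recurrences have J-fraction generating functions at height 0 (`hasJFraction_of_recurrence`). -/

open Finset

/-! ### J-fractions and weighted Motzkin paths -/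

/-- The powers `z ^ k J₀ J₁ ⋯ J_k` of convergents with `d` levels in total: the generating function
of the weighted Motzkin paths that end at height `k` and stay below height `d`. -/
noncomputable def jFractionProd {R : Type*} [CommRing R] (b c : ℕ → R) (d k : ℕ) :
    PowerSeries R :=
  PowerSeries.X ^ k * ∏ i ∈ range (k + 1), jFractionAux b c (d - i) i

theorem jFractionAux_eq {R : Type*} [CommRing R] (b c : ℕ → R) (d m : ℕ) :
    jFractionAux b c (d + 1) m = 1 + PowerSeries.X * (PowerSeries.C (b m) * jFractionAux b c (d + 1) m
      + PowerSeries.C (c m) * (PowerSeries.X *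
        (jFractionAux b c (d + 1) m * jFractionAux b c d (m + 1)))) := by
  linear_combination denominator_mul_jFractionAux b c d m

theorem jFractionProd_zero {R : Type*} [CommRing R] (b c : ℕ → R) {d : ℕ} (hd : 0 < d) :
    jFractionProd b c d 0 = 1 + PowerSeries.X * (PowerSeries.C (b 0) * jFractionProd b c d 0
      + PowerSeries.C (c 0) * jFractionProd b c d 1) := by
  obtain ⟨d, rfl⟩ := Nat.exists_eq_add_of_lt hd
  have h := jFractionAux_eq b c d 0
  simp only [jFractionProd, prod_range_succ, range_zero, prod_empty, pow_zero, pow_one, one_mul,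
    zero_add, Nat.sub_zero, Nat.add_sub_cancel] at h ⊢
  linear_combination h

/-- This is the defining equation of the factor at level `k + 1`, multiplied by `X ^ (k + 1)` and
the factors at lower levels. Its three terms correspond to a last step up, level or down. -/
theorem jFractionProd_succ {R : Type*} [CommRing R] (b c : ℕ → R) {d k : ℕ} (hd : k + 1 < d) :
    jFractionProd b c d (k + 1) = PowerSeries.X * (jFractionProd b c d k
      + PowerSeries.C (b (k + 1)) * jFractionProd b c d (k + 1)
      + PowerSeries.C (c (k + 1)) * jFractionProd b c d (k + 2)) := by
  obtain ⟨e, rfl⟩ := Nat.exists_eq_add_of_lt hd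
  have h := jFractionAux_eq b c e (k + 1)
  have h1 : k + 1 + e + 1 - (k + 1) = e + 1 := by omega
  have h2 : k + 1 + e + 1 - (k + 2) = e := by omega
  simp only [jFractionProd]
  rw [prod_range_succ _ (k + 2), prod_range_succ _ (k + 1), h1, h2]
  linear_combination
    (PowerSeries.X ^ (k + 1) * ∏ i ∈ range (k + 1), jFractionAux b c (k + 1 + e + 1 - i) i) * h

/-- Both sides obey the same recurrence as long as the truncation is not felt. The bound `n + k < d`
is inherited: the step lowers `n` by one and raises `k` by at most one. -/
theorem coeff_jFractionProd {R : Type*} [CommRing R] {b c : ℕ → R} {W : ℕ → ℕ → R}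
    (h_init : ∀ k, W 0 k = if k = 0 then 1 else 0)
    (h_zero : ∀ n, W (n + 1) 0 = b 0 * W n 0 + c 0 * W n 1)
    (h_succ : ∀ n k, W (n + 1) (k + 1) =
      W n k + b (k + 1) * W n (k + 1) + c (k + 1) * W n (k + 2))
    {d n k : ℕ} (h : n + k < d) :
    PowerSeries.coeff n (jFractionProd b c d k) = W n k := by
  induction n generalizing k with
  | zero =>
    cases k with
    | zero => rw [jFractionProd_zero b c (by omega)]; simp [h_init]
    | succ k => rw [jFractionProd_succ b c (by omega)]; simp [h_init]
  | succ n ih =>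
    cases k with
    | zero =>
      rw [jFractionProd_zero b c (by omega), map_add, PowerSeries.coeff_succ_X_mul, h_zero]
      simp only [map_add, PowerSeries.coeff_C_mul, PowerSeries.coeff_one]
      rw [ih (by omega), ih (by omega)]
      simp
    | succ k =>
      rw [jFractionProd_succ b c (by omega), PowerSeries.coeff_succ_X_mul, h_succ]
      simp only [map_add, PowerSeries.coeff_C_mul]
      rw [ih (by omega), ih (by omega), ih (by omega)]

/-- A family satisfying the recurrence of weighted Motzkin paths from height `0` to height `k` has
a J-fraction expansion for its entries at height `0`. -/
theorem hasJFraction_of_recurrence {R : Type*} [CommRing R] {b c : ℕ → R} {W : ℕ → ℕ → R}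
    (h_init : ∀ k, W 0 k = if k = 0 then 1 else 0)
    (h_zero : ∀ n, W (n + 1) 0 = b 0 * W n 0 + c 0 * W n 1)
    (h_succ : ∀ n k, W (n + 1) (k + 1) =
      W n k + b (k + 1) * W n (k + 1) + c (k + 1) * W n (k + 2)) :
    HasJFraction (PowerSeries.mk fun n => W n 0) b c := by
  intro n
  filter_upwards [Filter.eventually_gt_atTop n] with d hd
  have h := coeff_jFractionProd h_init h_zero h_succ (k := 0) hd
  simpa [jFractionProd, jFractionConvergent] using h

/-! ### Summing over the choice of an open block -/

theorem pqNumber_succ {R : Type*} [CommRing R] (p q : R) (k : ℕ) :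
    pqNumber p q (k + 1) = p * pqNumber p q k + q ^ k := by
  unfold pqNumber
  rw [sum_range_succ', mul_sum]
  simp only [pow_zero, one_mul, Nat.add_sub_cancel, Nat.sub_zero]
  congr 1
  refine sum_congr rfl fun i _ => ?_
  rw [show k - (i + 1) = k - 1 - i by omega]
  ring

/-- A new maximum lies to the right of all old points, giving each old term a factor `p`, and itself
contributes `q ^ #O`. This is the recurrence `pqNumber_succ`. -/
theorem sum_pow_card_gt_mul_pow_card_lt {R : Type*} [CommRing R] (p q : R) (O : Finset ℕ) :
    ∑ a ∈ O, p ^ #{o ∈ O | a < o} * q ^ #{o ∈ O | o < a} = pqNumber p q #O := by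
  induction O using Finset.induction_on_max with
  | empty => simp [pqNumber]
  | insert m O hm ih =>
    have hmO : m ∉ O := fun h => lt_irrefl _ (hm m h)
    rw [sum_insert hmO, card_insert_of_notMem hmO, pqNumber_succ, ← ih, add_comm, mul_sum]
    congr 1
    · refine sum_congr rfl fun a ha => ?_
      rw [filter_insert, if_pos (hm a ha), filter_insert, if_neg (hm a ha).not_gt,
        card_insert_of_notMem (by simp [hmO])]
      ring
    · rw [filter_insert, if_neg (lt_irrefl _), filter_insert, if_neg (lt_irrefl _),
        filter_true_of_mem hm, filter_false_of_mem fun x hx => (hm x hx).not_gt]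
      simp

/-! ### Crossings and nestings of arcs and half-arcs -/

/-- The number of crossings in a set of arcs. -/
def arcCr (E : Finset (ℕ × ℕ)) : ℕ :=
  #{e ∈ E ×ˢ E | e.1.1 < e.2.1 ∧ e.2.1 < e.1.2 ∧ e.1.2 < e.2.2}

/-- The number of nestings in a set of arcs. -/
def arcNe (E : Finset (ℕ × ℕ)) : ℕ :=
  #{e ∈ E ×ˢ E | e.1.1 < e.2.1 ∧ e.2.1 < e.2.2 ∧ e.2.2 < e.1.2}

/-- The number of crossings of the arcs in `E` with half-arcs starting at the points of `O`. -/
def halfCr (E : Finset (ℕ × ℕ)) (O : Finset ℕ) : ℕ :=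
  #{x ∈ E ×ˢ O | x.1.1 < x.2 ∧ x.2 < x.1.2}

/-- The number of nestings of the arcs in `E` with half-arcs starting at the points of `O`. -/
def halfNe (E : Finset (ℕ × ℕ)) (O : Finset ℕ) : ℕ :=
  #{x ∈ E ×ˢ O | x.2 < x.1.1}

section Statistics

variable {E : Finset (ℕ × ℕ)} {O : Finset ℕ} {n a : ℕ}

/-- An arc ending to the right of everything else can only be the right-hand arc of a crossing;
likewise it can only be the outer arc of a nesting. -/
theorem arcCr_insert (hE : ∀ e ∈ E, e.1 < e.2 ∧ e.2 ≤ n) :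
    arcCr (insert (a, n + 1) E) = arcCr E + #{e ∈ E | e.1 < a ∧ a < e.2} := by
  have hn : (a, n + 1) ∉ E := fun h => by have := (hE _ h).2; simp at this
  simp only [arcCr, card_filter, sum_product, sum_insert hn, sum_add_distrib, lt_irrefl, false_and,
    if_false, zero_add]
  have h1 : ∑ x ∈ E, (if a < x.1 ∧ x.1 < n + 1 ∧ n + 1 < x.2 then 1 else 0) = 0 :=
    sum_eq_zero fun x hx => if_neg fun h => by have := hE x hx; omega
  have h2 : ∑ x ∈ E, (if x.1 < a ∧ a < x.2 ∧ x.2 < n + 1 then 1 else 0)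
      = ∑ x ∈ E, (if x.1 < a ∧ a < x.2 then 1 else 0) :=
    sum_congr rfl fun x hx => if_congr (by have := hE x hx; omega) rfl rfl
  rw [h1, h2]
  omega

theorem arcNe_insert (hE : ∀ e ∈ E, e.1 < e.2 ∧ e.2 ≤ n) :
    arcNe (insert (a, n + 1) E) = arcNe E + #{e ∈ E | a < e.1} := by
  have hn : (a, n + 1) ∉ E := fun h => by have := (hE _ h).2; simp at this
  simp only [arcNe, card_filter, sum_product, sum_insert hn, sum_add_distrib, lt_irrefl, false_and,
    if_false, zero_add]
  have h1 : ∑ x ∈ E, (if a < x.1 ∧ x.1 < x.2 ∧ x.2 < n + 1 then 1 else 0)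
      = ∑ x ∈ E, (if a < x.1 then 1 else 0) :=
    sum_congr rfl fun x hx => if_congr (by have := hE x hx; omega) rfl rfl
  have h2 : ∑ x ∈ E, (if x.1 < a ∧ a < n + 1 ∧ n + 1 < x.2 then 1 else 0) = 0 :=
    sum_eq_zero fun x hx => if_neg fun h => by have := hE x hx; omega
  rw [h1, h2]
  omega

theorem halfCr_insert_point (hE : ∀ e ∈ E, e.1 < e.2 ∧ e.2 ≤ n + 1) :
    halfCr E (insert (n + 1) O) = halfCr E O := by
  unfold halfCr
  congr 1
  ext ⟨e, o⟩
  simp only [mem_filter, mem_product, mem_insert]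
  constructor
  · rintro ⟨⟨he, rfl | ho⟩, h⟩
    · have := hE e he
      omega
    · exact ⟨⟨he, ho⟩, h⟩
  · rintro ⟨⟨he, ho⟩, h⟩
    exact ⟨⟨he, Or.inr ho⟩, h⟩

theorem halfNe_insert_point (hE : ∀ e ∈ E, e.1 < e.2 ∧ e.2 ≤ n + 1) :
    halfNe E (insert (n + 1) O) = halfNe E O := by
  unfold halfNe
  congr 1
  ext ⟨e, o⟩
  simp only [mem_filter, mem_product, mem_insert]
  constructor
  · rintro ⟨⟨he, rfl | ho⟩, h⟩
    · have := hE e he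
      omega
    · exact ⟨⟨he, ho⟩, h⟩
  · rintro ⟨⟨he, ho⟩, h⟩
    exact ⟨⟨he, Or.inr ho⟩, h⟩

theorem halfCr_erase (ha : a ∈ O) :
    halfCr E (O.erase a) + #{e ∈ E | e.1 < a ∧ a < e.2} = halfCr E O := by
  simp only [halfCr, card_filter, sum_product, ← sum_add_distrib]
  exact sum_congr rfl fun e _ => sum_erase_add O _ ha

theorem halfNe_erase (ha : a ∈ O) :
    halfNe E (O.erase a) + #{e ∈ E | a < e.1} = halfNe E O := by
  simp only [halfNe, card_filter, sum_product, ← sum_add_distrib]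
  exact sum_congr rfl fun e _ => sum_erase_add O _ ha

theorem halfCr_insert_arc (hE : ∀ e ∈ E, e.2 ≤ n) (hO : ∀ o ∈ O, o ≤ n) :
    halfCr (insert (a, n + 1) E) (O.erase a) = halfCr E (O.erase a) + #{o ∈ O | a < o} := by
  have hn : (a, n + 1) ∉ E := fun h => by have := hE _ h; simp at this
  simp only [halfCr, card_filter, sum_product, sum_insert hn]
  rw [add_comm]
  congr 1
  -- The point `a` itself does not satisfy `a < o`, so erasing it does not change the count.
  rw [← sum_erase O (a := a) (f := fun o => if a < o then 1 else 0) (by simp)]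
  refine sum_congr rfl fun o ho => if_congr ?_ rfl rfl
  have := hO o (mem_of_mem_erase ho)
  omega

theorem halfNe_insert_arc (hE : ∀ e ∈ E, e.2 ≤ n) :
    halfNe (insert (a, n + 1) E) (O.erase a) = halfNe E (O.erase a) + #{o ∈ O | o < a} := by
  have hn : (a, n + 1) ∉ E := fun h => by have := hE _ h; simp at this
  simp only [halfNe, card_filter, sum_product, sum_insert hn]
  rw [add_comm]
  congr 1
  exact sum_erase O (a := a) (f := fun o => if o < a then 1 else 0) (by simp)

/-- The crossings of the half-arc at `a` with complete arcs become crossings of arcs and cancel in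
the total. Only the crossings of the new arc with the remaining half-arcs are new. -/
theorem cr_close (hE : ∀ e ∈ E, e.1 < e.2 ∧ e.2 ≤ n) (hO : ∀ o ∈ O, o ≤ n) (ha : a ∈ O) :
    arcCr (insert (a, n + 1) E) + halfCr (insert (a, n + 1) E) (O.erase a)
      = arcCr E + halfCr E O + #{o ∈ O | a < o} := by
  rw [arcCr_insert hE, halfCr_insert_arc (fun e he => (hE e he).2) hO,
    ← halfCr_erase ha]
  omega

theorem ne_close (hE : ∀ e ∈ E, e.1 < e.2 ∧ e.2 ≤ n) (ha : a ∈ O) :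
    arcNe (insert (a, n + 1) E) + halfNe (insert (a, n + 1) E) (O.erase a)
      = arcNe E + halfNe E O + #{o ∈ O | o < a} := by
  rw [arcNe_insert hE, halfNe_insert_arc (fun e he => (hE e he).2), ← halfNe_erase ha]
  omega

end Statistics

/-! ### Weights of arc systems -/

/-- The points of `[n]` that are the left end of an arc or of a half-arc. -/
def starts (E : Finset (ℕ × ℕ)) (O : Finset ℕ) : Finset ℕ := E.image Prod.fst ∪ O

/-- The right ends of the arcs. -/
def rightEnds (E : Finset (ℕ × ℕ)) : Finset ℕ := E.image Prod.snd

/-- The weight of a set `E` of arcs on `[n]` with half-arcs starting at the points of `O`. -/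
def arcWeight {R : Type*} [CommRing R] (p q u₁ u₂ v : R) (n : ℕ) (E : Finset (ℕ × ℕ))
    (O : Finset ℕ) : R :=
  p ^ (arcCr E + halfCr E O) * q ^ (arcNe E + halfNe E O)
    * u₁ ^ #(Icc 1 n \ (starts E O ∪ rightEnds E))
    * u₂ ^ #(rightEnds E \ starts E O) * v ^ #(rightEnds E ∩ starts E O)

section Weight

variable {R : Type*} [CommRing R] (p q u₁ u₂ v : R) {E : Finset (ℕ × ℕ)} {O : Finset ℕ} {n a : ℕ}

theorem succ_notMem_starts (hE : ∀ e ∈ E, e.1 < e.2 ∧ e.2 ≤ n) (hO : ∀ o ∈ O, o ≤ n) :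
    n + 1 ∉ starts E O := by
  simp only [starts, mem_union, mem_image, not_or, not_exists, not_and]
  exact ⟨fun e he h => by have := hE e he; omega, fun h => by have := hO _ h; omega⟩

theorem succ_notMem_rightEnds (hE : ∀ e ∈ E, e.1 < e.2 ∧ e.2 ≤ n) : n + 1 ∉ rightEnds E := by
  simp only [rightEnds, mem_image, not_exists, not_and]
  exact fun e he h => by have := hE e he; omega

theorem starts_insert_point : starts E (insert a O) = insert a (starts E O) := by
  simp [starts]

theorem starts_close {b : ℕ} (ha : a ∈ O) : starts (insert (a, b) E) (O.erase a) = starts E O := by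
  rw [starts, starts, image_insert, insert_union, ← union_insert, insert_erase ha]

theorem rightEnds_insert {b : ℕ} : rightEnds (insert (a, b) E) = insert b (rightEnds E) := by
  simp [rightEnds]

theorem Icc_one_succ : Icc 1 (n + 1) = insert (n + 1) (Icc 1 n) := by
  ext x
  simp only [mem_Icc, mem_insert]
  omega

theorem Icc_succ_sdiff_insert (S : Finset ℕ) :
    Icc 1 (n + 1) \ insert (n + 1) S = Icc 1 n \ S := by
  ext x
  simp only [mem_Icc, mem_insert, mem_sdiff]
  constructor
  · rintro ⟨h, h'⟩
    exact ⟨by omega, fun hx => h' (Or.inr hx)⟩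
  · rintro ⟨h, h'⟩
    exact ⟨by omega, fun hx => hx.elim (by omega) h'⟩

theorem arcWeight_singleton (hE : ∀ e ∈ E, e.1 < e.2 ∧ e.2 ≤ n) (hO : ∀ o ∈ O, o ≤ n) :
    arcWeight p q u₁ u₂ v (n + 1) E O = u₁ * arcWeight p q u₁ u₂ v n E O := by
  have h1 := succ_notMem_starts hE hO
  have h2 := succ_notMem_rightEnds hE
  rw [arcWeight, arcWeight, Icc_one_succ, insert_sdiff_of_notMem _ (by simp [h1, h2]),
    card_insert_of_notMem (by simp)]
  ring

theorem arcWeight_open (hE : ∀ e ∈ E, e.1 < e.2 ∧ e.2 ≤ n) :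
    arcWeight p q u₁ u₂ v (n + 1) E (insert (n + 1) O) = arcWeight p q u₁ u₂ v n E O := by
  have hE' : ∀ e ∈ E, e.1 < e.2 ∧ e.2 ≤ n + 1 := fun e he => ⟨(hE e he).1, by have := hE e he; omega⟩
  have h2 := succ_notMem_rightEnds hE
  rw [arcWeight, arcWeight, halfCr_insert_point hE', halfNe_insert_point hE',
    starts_insert_point, insert_union, Icc_succ_sdiff_insert, sdiff_insert_of_notMem h2,
    inter_insert_of_notMem h2]

/-- The factor `u₂` is paid when a block is closed: `n + 1` becomes a right end that starts nothing,
while `a` remains a start. -/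
theorem arcWeight_close (hE : ∀ e ∈ E, e.1 < e.2 ∧ e.2 ≤ n) (hO : ∀ o ∈ O, o ≤ n) (ha : a ∈ O) :
    arcWeight p q u₁ u₂ v (n + 1) (insert (a, n + 1) E) (O.erase a)
      = p ^ #{o ∈ O | a < o} * q ^ #{o ∈ O | o < a} * (u₂ * arcWeight p q u₁ u₂ v n E O) := by
  have h1 := succ_notMem_starts hE hO
  have h2 := succ_notMem_rightEnds hE
  rw [arcWeight, arcWeight, cr_close hE hO ha, ne_close hE ha, starts_close ha, rightEnds_insert,
    union_insert, Icc_succ_sdiff_insert, insert_sdiff_of_notMem _ h1,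
    card_insert_of_notMem (by simp [h2]), insert_inter_of_notMem h1]
  ring

theorem arcWeight_transient (hE : ∀ e ∈ E, e.1 < e.2 ∧ e.2 ≤ n) (hO : ∀ o ∈ O, o ≤ n)
    (ha : a ∈ O) :
    arcWeight p q u₁ u₂ v (n + 1) (insert (a, n + 1) E) (insert (n + 1) (O.erase a))
      = p ^ #{o ∈ O | a < o} * q ^ #{o ∈ O | o < a} * (v * arcWeight p q u₁ u₂ v n E O) := by
  have h1 := succ_notMem_starts hE hO
  have h2 := succ_notMem_rightEnds hE
  have hE' : ∀ e ∈ insert (a, n + 1) E, e.1 < e.2 ∧ e.2 ≤ n + 1 := by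
    intro e he
    rcases mem_insert.1 he with rfl | he
    · have := hO a ha
      simp only
      omega
    · have := hE e he
      omega
  rw [arcWeight, arcWeight, halfCr_insert_point hE', halfNe_insert_point hE', cr_close hE hO ha,
    ne_close hE ha, starts_insert_point, starts_close ha, rightEnds_insert,
    ← insert_union_distrib, Icc_succ_sdiff_insert, insert_sdiff_insert, sdiff_insert_of_notMem h2,
    ← insert_inter_distrib, card_insert_of_notMem (by simp [h2])]
  ring

end Weight

/-! ### Edges and greatest elements of blocks -/

namespace SetPartition

variable {n : ℕ}

theorem mem_edges {π : SetPartition n} {i j : ℕ} :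
    (i, j) ∈ π.edges ↔
      i < j ∧ ∃ B ∈ π.parts, i ∈ B ∧ j ∈ B ∧ ∀ x ∈ B, ¬(i < x ∧ x < j) := by
  simp only [edges, mem_filter, mem_product, and_iff_right_iff_imp]
  rintro ⟨_, B, hB, hi, hj, _⟩
  exact ⟨π.subset hB hi, π.subset hB hj⟩

theorem lt_and_le_of_mem_edges {π : SetPartition n} : ∀ e ∈ π.edges, e.1 < e.2 ∧ e.2 ≤ n := by
  rintro ⟨i, j⟩ h
  obtain ⟨hij, B, hB, _, hj, _⟩ := mem_edges.1 h
  exact ⟨hij, (mem_Icc.1 (π.subset hB hj)).2⟩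

theorem mem_image_fst_edges {π : SetPartition n} {a : ℕ} {B : Finset ℕ} (hB : B ∈ π.parts)
    (ha : a ∈ B) : a ∈ π.edges.image Prod.fst ↔ ∃ y ∈ B, a < y := by
  simp only [mem_image, Prod.exists, exists_and_right, exists_eq_right]
  constructor
  · rintro ⟨j, h⟩
    obtain ⟨hij, B', hB', hi, hj, _⟩ := mem_edges.1 h
    obtain rfl := π.eq_of_mem_parts hB hB' ha hi
    exact ⟨j, hj, hij⟩
  · rintro ⟨y, hy, hay⟩
    have hne : (B.filter (a < ·)).Nonempty := ⟨y, mem_filter.2 ⟨hy, hay⟩⟩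
    have hm := mem_filter.1 (min'_mem _ hne)
    refine ⟨_, mem_edges.2 ⟨hm.2, B, hB, ha, hm.1, fun x hx hlt => ?_⟩⟩
    exact (min'_le _ x (mem_filter.2 ⟨hx, hlt.1⟩)).not_gt hlt.2

theorem mem_rightEnds_edges {π : SetPartition n} {a : ℕ} {B : Finset ℕ} (hB : B ∈ π.parts)
    (ha : a ∈ B) : a ∈ rightEnds π.edges ↔ ∃ y ∈ B, y < a := by
  simp only [rightEnds, mem_image, Prod.exists, exists_eq_right]
  constructor
  · rintro ⟨i, h⟩
    obtain ⟨hij, B', hB', hi, hj, _⟩ := mem_edges.1 h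
    obtain rfl := π.eq_of_mem_parts hB hB' ha hj
    exact ⟨i, hi, hij⟩
  · rintro ⟨y, hy, hay⟩
    have hne : (B.filter (· < a)).Nonempty := ⟨y, mem_filter.2 ⟨hy, hay⟩⟩
    have hm := mem_filter.1 (max'_mem _ hne)
    refine ⟨_, mem_edges.2 ⟨hm.2, B, hB, hm.1, ha, fun x hx hlt => ?_⟩⟩
    exact (le_max' _ x (mem_filter.2 ⟨hx, hlt.2⟩)).not_gt hlt.1

/-- The greatest elements of the blocks. -/
def tails (π : SetPartition n) : Finset ℕ := Icc 1 n \ π.edges.image Prod.fst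

theorem sup_id_mem {B : Finset ℕ} (h : B.Nonempty) : B.sup id ∈ B := by
  obtain ⟨b, hb, h⟩ := exists_mem_eq_sup B h id
  exact h ▸ hb

theorem mem_tails {π : SetPartition n} {a : ℕ} {B : Finset ℕ} (hB : B ∈ π.parts)
    (ha : a ∈ B) : a ∈ π.tails ↔ B.sup id = a := by
  rw [tails, mem_sdiff, mem_image_fst_edges hB ha, and_iff_right (π.subset hB ha)]
  push Not
  constructor
  · exact fun h => le_antisymm (Finset.sup_le h) (le_sup (f := id) ha)
  · rintro rfl y hy
    exact le_sup (f := id) hy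

theorem sum_parts_sup {M : Type*} [AddCommMonoid M] (π : SetPartition n) (f : ℕ → M) :
    ∑ B ∈ π.parts, f (B.sup id) = ∑ a ∈ π.tails, f a := by
  have hsup : ∀ B ∈ π.parts, B.sup id ∈ B := fun B hB => sup_id_mem (π.nonempty_of_mem_parts hB)
  refine sum_bij (fun B _ => B.sup id) (fun B hB => (mem_tails hB (hsup B hB)).2 rfl)
    (fun B hB B' hB' h => ?_) (fun a ha => ?_) fun _ _ => rfl
  · exact π.eq_of_mem_parts hB hB' (hsup B hB) (h ▸ hsup B' hB')
  · obtain ⟨B, hB, haB⟩ := π.exists_mem (mem_sdiff.1 ha).1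
    exact ⟨B, hB, (mem_tails hB haB).1 ha⟩

/-! ### Inserting and removing the last point -/

/-- `π'` arises from `π` by adding `n + 1` to the block `B`, or as a singleton if `B = ∅`. -/
def IsInsertion (π' : SetPartition (n + 1)) (π : SetPartition n) (B : Finset ℕ) : Prop :=
  π'.parts = insert (insert (n + 1) B) (π.parts.erase B)

theorem subset_of_mem_insert {π : SetPartition n} {B : Finset ℕ} (hB : B ∈ insert ∅ π.parts) :
    B ⊆ Icc 1 n := by
  rcases mem_insert.1 hB with rfl | hB
  · exact empty_subset _
  · exact π.subset hB

theorem succ_notMem_of_subset {B : Finset ℕ} (hB : B ⊆ Icc 1 n) : n + 1 ∉ B := fun h => by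
  have := mem_Icc.1 (hB h)
  omega

theorem exists_isInsertion (π : SetPartition n) {B : Finset ℕ} (hB : B ∈ insert ∅ π.parts) :
    ∃ π' : SetPartition (n + 1), IsInsertion π' π B := by
  have hsub : Icc 1 n ⊆ Icc 1 (n + 1) := Icc_subset_Icc_right (Nat.le_succ n)
  have hBs := subset_of_mem_insert hB
  refine ⟨Finpartition.ofExistsUnique (insert (insert (n + 1) B) (π.parts.erase B)) ?_ ?_ ?_, rfl⟩
  · intro C hC
    rcases mem_insert.1 hC with rfl | hC
    · exact insert_subset (by simp) (hBs.trans hsub)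
    · exact (π.subset (mem_of_mem_erase hC)).trans hsub
  · intro a ha
    by_cases haB : a ∈ insert (n + 1) B
    · refine ⟨insert (n + 1) B, ⟨mem_insert_self _ _, haB⟩, ?_⟩
      rintro C ⟨hC, haC⟩
      rcases mem_insert.1 hC with rfl | hC
      · rfl
      · obtain ⟨hne, hC⟩ := mem_erase.1 hC
        rcases mem_insert.1 haB with rfl | haB
        · exact absurd haC (succ_notMem_of_subset (π.subset hC))
        · rcases mem_insert.1 hB with rfl | hB
          · simp at haB
          · exact absurd (π.eq_of_mem_parts hC hB haC haB) hne
    · have han : a ∈ Icc 1 n := by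
        rw [Icc_one_succ, mem_insert] at ha
        exact ha.resolve_left fun h => haB (h ▸ mem_insert_self _ _)
      obtain ⟨C, hC, haC⟩ := π.exists_mem han
      refine ⟨C, ⟨mem_insert_of_mem (mem_erase.2 ⟨?_, hC⟩), haC⟩, ?_⟩
      · rintro rfl
        exact haB (mem_insert_of_mem haC)
      · rintro D ⟨hD, haD⟩
        rcases mem_insert.1 hD with rfl | hD
        · exact absurd haD haB
        · exact π.eq_of_mem_parts (mem_of_mem_erase hD) hC haD haC
  · rw [mem_insert, not_or]
    exact ⟨(insert_ne_empty _ _).symm, fun h => π.empty_notMem_parts (mem_of_mem_erase h)⟩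

/-- The partition of `[n]` induced by a partition of `[n + 1]`. -/
def removeLast (π' : SetPartition (n + 1)) : SetPartition n :=
  (π'.avoid {n + 1}).copy (by ext x; simp only [mem_sdiff, mem_Icc, mem_singleton]; omega)

theorem mem_removeLast {π' : SetPartition (n + 1)} {C : Finset ℕ} :
    C ∈ π'.removeLast.parts ↔ ∃ D ∈ π'.parts, D.erase (n + 1) = C ∧ C.Nonempty := by
  simp only [removeLast, Finpartition.copy, Finpartition.mem_avoid, sdiff_singleton_eq_erase]
  refine exists_congr fun D => and_congr_right fun _ => ?_
  rw [and_comm]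
  refine and_congr_right ?_
  rintro rfl
  rw [← sdiff_singleton_eq_erase, sdiff_nonempty]

theorem succ_mem_Icc : n + 1 ∈ Icc 1 (n + 1) := by simp

theorem part_erase_mem (π' : SetPartition (n + 1)) :
    (π'.part (n + 1)).erase (n + 1) ∈ insert ∅ π'.removeLast.parts := by
  rcases ((π'.part (n + 1)).erase (n + 1)).eq_empty_or_nonempty with h | h
  · rw [h]
    exact mem_insert_self _ _
  · exact mem_insert_of_mem (mem_removeLast.2 ⟨_, π'.part_mem.2 succ_mem_Icc, rfl, h⟩)

theorem isInsertion_removeLast (π' : SetPartition (n + 1)) :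
    IsInsertion π' π'.removeLast ((π'.part (n + 1)).erase (n + 1)) := by
  have hP := π'.part_mem.2 (succ_mem_Icc (n := n))
  have hmem : n + 1 ∈ π'.part (n + 1) := π'.mem_part_self.2 succ_mem_Icc
  rw [IsInsertion, insert_erase hmem]
  have key : ∀ D ∈ π'.parts, D ≠ π'.part (n + 1) → n + 1 ∉ D := fun D hD hne h =>
    hne (π'.eq_of_mem_parts hD hP h hmem)
  ext C
  simp only [mem_insert, mem_erase, mem_removeLast]
  constructor
  · intro hC
    by_cases hCP : C = π'.part (n + 1)
    · exact Or.inl hCP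
    · refine Or.inr ⟨?_, C, hC, erase_eq_of_notMem (key C hC hCP), π'.nonempty_of_mem_parts hC⟩
      rintro h
      obtain ⟨x, hx⟩ := π'.nonempty_of_mem_parts hC
      exact hCP (π'.eq_of_mem_parts hC hP hx (mem_of_mem_erase (h ▸ hx)))
  · rintro (rfl | ⟨hne, D, hD, rfl, _⟩)
    · exact hP
    · have hDP : D ≠ π'.part (n + 1) := fun h => hne (by rw [h])
      rwa [erase_eq_of_notMem (key D hD hDP)]

theorem IsInsertion.part_erase {π' : SetPartition (n + 1)} {π : SetPartition n} {B : Finset ℕ}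
    (h : IsInsertion π' π B) (hB : B ∈ insert ∅ π.parts) :
    (π'.part (n + 1)).erase (n + 1) = B := by
  have h1 : insert (n + 1) B ∈ π'.parts := by rw [h]; exact mem_insert_self _ _
  rw [π'.part_eq_of_mem h1 (mem_insert_self _ _),
    erase_insert (succ_notMem_of_subset (subset_of_mem_insert hB))]

theorem IsInsertion.removeLast_eq {π' : SetPartition (n + 1)} {π : SetPartition n} {B : Finset ℕ}
    (h : IsInsertion π' π B) (hB : B ∈ insert ∅ π.parts) : π'.removeLast = π := by
  have hn := succ_notMem_of_subset (subset_of_mem_insert hB)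
  ext1
  ext C
  rw [mem_removeLast, h]
  constructor
  · rintro ⟨D, hD, rfl, hne⟩
    rcases mem_insert.1 hD with rfl | hD
    · rw [erase_insert hn] at hne ⊢
      exact (mem_insert.1 hB).resolve_left hne.ne_empty
    · have hD := mem_of_mem_erase hD
      rwa [erase_eq_of_notMem (succ_notMem_of_subset (π.subset hD))]
  · intro hC
    by_cases hCB : C = B
    · subst hCB
      exact ⟨_, mem_insert_self _ _, erase_insert hn, π.nonempty_of_mem_parts hC⟩
    · exact ⟨C, mem_insert_of_mem (mem_erase.2 ⟨hCB, hC⟩),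
        erase_eq_of_notMem (succ_notMem_of_subset (π.subset hC)), π.nonempty_of_mem_parts hC⟩

/-- Since `n + 1` exceeds all other points, it separates no consecutive pair, and its only possible
neighbour is the maximum of `B`. -/
theorem IsInsertion.edges_eq {π' : SetPartition (n + 1)} {π : SetPartition n} {B : Finset ℕ}
    (h : IsInsertion π' π B) (hB : B ∈ insert ∅ π.parts) :
    π'.edges = if B = ∅ then π.edges else insert (B.sup id, n + 1) π.edges := by
  have hn := succ_notMem_of_subset (subset_of_mem_insert hB)
  have hmem : ∀ e, e ∈ (if B = ∅ then π.edges else insert (B.sup id, n + 1) π.edges) ↔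
      e ∈ π.edges ∨ B ≠ ∅ ∧ e = (B.sup id, n + 1) := by
    intro e
    split_ifs with hB0
    · simp [hB0]
    · simp [hB0, or_comm]
  ext ⟨i, j⟩
  rw [hmem, mem_edges, mem_edges, h]
  constructor
  · rintro ⟨hij, C, hC, hi, hj, hx⟩
    rcases mem_insert.1 hC with rfl | hC
    · have hjn : j ≤ n + 1 := by
        rcases mem_insert.1 hj with rfl | hj
        · exact le_rfl
        · exact (mem_Icc.1 (subset_of_mem_insert hB hj)).2.trans (Nat.le_succ n)
      have hiB : i ∈ B := (mem_insert.1 hi).resolve_left (by omega)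
      have hB0 : B ≠ ∅ := ne_empty_of_mem hiB
      rcases mem_insert.1 hj with rfl | hjB
      · refine Or.inr ⟨hB0, Prod.ext ?_ rfl⟩
        -- No element of `B` lies strictly between `i` and `n + 1`, so `i` is the maximum of `B`.
        refine le_antisymm (le_sup (f := id) hiB) (Finset.sup_le fun x hxB => ?_)
        have h1 := hx x (mem_insert_of_mem hxB)
        have h2 := (mem_Icc.1 (subset_of_mem_insert hB hxB)).2
        simp only [id]
        omega
      · exact Or.inl ⟨hij, B, (mem_insert.1 hB).resolve_left hB0, hiB, hjB,
          fun x hxB => hx x (mem_insert_of_mem hxB)⟩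
    · exact Or.inl ⟨hij, C, mem_of_mem_erase hC, hi, hj, hx⟩
  · rintro (⟨hij, C, hC, hi, hj, hx⟩ | ⟨hB0, he⟩)
    · refine ⟨hij, ?_⟩
      by_cases hCB : C = B
      · subst hCB
        refine ⟨_, mem_insert_self _ _, mem_insert_of_mem hi, mem_insert_of_mem hj, fun x hxC => ?_⟩
        rcases mem_insert.1 hxC with rfl | hxC
        · have := (mem_Icc.1 (π.subset hC hj)).2
          omega
        · exact hx x hxC
      · exact ⟨C, mem_insert_of_mem (mem_erase.2 ⟨hCB, hC⟩), hi, hj, hx⟩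
    · obtain ⟨rfl, rfl⟩ := Prod.mk.inj he
      have hs := sup_id_mem (nonempty_iff_ne_empty.2 hB0)
      have hle := (mem_Icc.1 (subset_of_mem_insert hB hs)).2
      refine ⟨by omega, _, mem_insert_self _ _, mem_insert_of_mem hs, mem_insert_self _ _,
        fun x hxB hlt => ?_⟩
      have hxB := (mem_insert.1 hxB).resolve_left (by omega)
      exact (le_sup (f := id) hxB).not_gt hlt.1

/-- A partition of `[n + 1]` amounts to a partition of `[n]` and a choice of a block, or of `∅`, to
receive `n + 1`; a block is encoded by its greatest element. -/
theorem sum_edges_succ {M : Type*} [AddCommMonoid M] (f : Finset (ℕ × ℕ) → M) :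
    ∑ π' : SetPartition (n + 1), f π'.edges =
      ∑ π : SetPartition n, (f π.edges + ∑ a ∈ π.tails, f (insert (a, n + 1) π.edges)) := by
  have h : ∀ π : SetPartition n,
      f π.edges + ∑ a ∈ π.tails, f (insert (a, n + 1) π.edges) = ∑ B ∈ insert ∅ π.parts,
        f (if B = ∅ then π.edges else insert (B.sup id, n + 1) π.edges) := by
    intro π
    rw [sum_insert π.empty_notMem_parts, if_pos rfl, ← π.sum_parts_sup]
    congr 1
    exact sum_congr rfl fun B hB => by rw [if_neg (π.ne_empty hB)]
  simp_rw [h]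
  rw [sum_sigma']
  refine sum_bij (fun π' _ => ⟨π'.removeLast, (π'.part (n + 1)).erase (n + 1)⟩) ?_ ?_ ?_ ?_
  · exact fun π' _ => mem_sigma.2 ⟨mem_univ _, part_erase_mem π'⟩
  · intro π₁ _ π₂ _ h
    obtain ⟨h1, h2⟩ := Sigma.mk.inj h
    ext1
    rw [isInsertion_removeLast π₁, isInsertion_removeLast π₂, h1, eq_of_heq h2]
  · rintro ⟨π, B⟩ hB
    have hB := (mem_sigma.1 hB).2
    obtain ⟨π', h⟩ := exists_isInsertion π hB
    exact ⟨π', mem_univ _, by rw [h.removeLast_eq hB, h.part_erase hB]⟩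
  · exact fun π' _ => by rw [(isInsertion_removeLast π').edges_eq (part_erase_mem π')]

end SetPartition

/-! ### Block statistics in terms of edges -/

namespace SetPartition

variable {n : ℕ}

theorem rightEnds_edges_subset (π : SetPartition n) : rightEnds π.edges ⊆ Icc 1 n := by
  intro x hx
  obtain ⟨⟨i, j⟩, he, rfl⟩ := mem_image.1 hx
  obtain ⟨_, B, hB, _, hj, _⟩ := mem_edges.1 he
  exact π.subset hB hj

theorem starts_empty {E : Finset (ℕ × ℕ)} : starts E ∅ = E.image Prod.fst := union_empty _

/-- A point is a left end unless it is the maximum of its block, and a right end unless it is the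
minimum. So the edges alone determine its type. -/
theorem sg_eq (π : SetPartition n) :
    π.sg = #(Icc 1 n \ (starts π.edges ∅ ∪ rightEnds π.edges)) := by
  rw [sg, ← filter_notMem_eq_sdiff]
  congr 1
  refine filter_congr fun x hx => ?_
  obtain ⟨B, hB, hxB⟩ := π.exists_mem hx
  rw [mem_union, starts_empty, mem_image_fst_edges hB hxB, mem_rightEnds_edges hB hxB]
  constructor
  · intro h
    obtain rfl := π.eq_of_mem_parts h hB (mem_singleton_self x) hxB
    simp
  · intro h
    push Not at h
    have : B = {x} := eq_singleton_iff_unique_mem.2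
      ⟨hxB, fun y hy => le_antisymm (h.1 y hy) (h.2 y hy)⟩
    exact this ▸ hB

theorem tr_eq (π : SetPartition n) : π.tr = #(rightEnds π.edges ∩ starts π.edges ∅) := by
  rw [tr]
  congr 1
  ext x
  simp only [mem_filter, mem_inter, starts_empty]
  constructor
  · rintro ⟨_, B, hB, _, hxB, h1, h2⟩
    exact ⟨(mem_rightEnds_edges hB hxB).2 h1, (mem_image_fst_edges hB hxB).2 h2⟩
  · rintro ⟨h1, h2⟩
    have hx := π.rightEnds_edges_subset h1
    obtain ⟨B, hB, hxB⟩ := π.exists_mem hx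
    rw [mem_rightEnds_edges hB hxB] at h1
    rw [mem_image_fst_edges hB hxB] at h2
    obtain ⟨y, hy, hyx⟩ := h1
    exact ⟨hx, B, hB, one_lt_card.2 ⟨x, hxB, y, hy, hyx.ne'⟩, hxB, ⟨y, hy, hyx⟩, h2⟩

theorem bl_eq (π : SetPartition n) : π.bl = #(rightEnds π.edges \ starts π.edges ∅) := by
  have hsup : ∀ B ∈ π.parts, B.sup id ∈ B := fun B hB => sup_id_mem (π.nonempty_of_mem_parts hB)
  have htails : ∀ a, a ∈ rightEnds π.edges \ starts π.edges ∅ ↔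
      a ∈ rightEnds π.edges ∧ a ∈ π.tails := by
    intro a
    rw [tails, mem_sdiff, mem_sdiff, starts_empty]
    exact ⟨fun h => ⟨h.1, π.rightEnds_edges_subset h.1, h.2⟩, fun h => ⟨h.1, h.2.2⟩⟩
  refine card_bij (fun B _ => B.sup id) (fun B hB => ?_) (fun B hB B' hB' h => ?_) (fun a ha => ?_)
  · obtain ⟨hB, hcard⟩ := mem_filter.1 hB
    refine (htails _).2 ⟨(mem_rightEnds_edges hB (hsup B hB)).2 ?_,
      (mem_tails hB (hsup B hB)).2 rfl⟩
    obtain ⟨y, hy, hne⟩ := exists_mem_ne hcard (B.sup id)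
    exact ⟨y, hy, lt_of_le_of_ne (le_sup (f := id) hy) hne⟩
  · have hB := (mem_filter.1 hB).1
    have hB' := (mem_filter.1 hB').1
    exact π.eq_of_mem_parts hB hB' (hsup B hB) (h ▸ hsup B' hB')
  · obtain ⟨h1, h2⟩ := (htails a).1 ha
    obtain ⟨B, hB, haB⟩ := π.exists_mem (π.rightEnds_edges_subset h1)
    obtain ⟨y, hy, hya⟩ := (mem_rightEnds_edges hB haB).1 h1
    exact ⟨B, mem_filter.2 ⟨hB, one_lt_card.2 ⟨a, haB, y, hy, hya.ne'⟩⟩,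
      (mem_tails hB haB).1 h2⟩

theorem weight_eq_arcWeight {R : Type*} [CommRing R] (p q u₁ u₂ v : R) (π : SetPartition n) :
    p ^ π.cr * q ^ π.ne * u₁ ^ π.sg * u₂ ^ π.bl * v ^ π.tr =
      arcWeight p q u₁ u₂ v n π.edges ∅ := by
  rw [arcWeight, sg_eq, bl_eq, tr_eq]
  simp [halfCr, halfNe, arcCr, arcNe, cr, ne]

end SetPartition

/-! ### Partitions with marked open blocks -/

theorem sum_powerset_sum_erase {M : Type*} [AddCommMonoid M] (s : Finset ℕ)
    (h : ℕ → Finset ℕ → M) :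
    ∑ a ∈ s, ∑ O ∈ (s.erase a).powerset, h a O = ∑ O ∈ s.powerset, ∑ a ∈ O, h a (O.erase a) := by
  rw [sum_sigma', sum_sigma']
  refine sum_bij' (fun x _ => ⟨insert x.1 x.2, x.1⟩) (fun x _ => ⟨x.2, x.1.erase x.2⟩)
    ?_ ?_ ?_ ?_ ?_
  · rintro ⟨a, O⟩ hx
    simp only [mem_sigma, mem_powerset] at hx ⊢
    exact ⟨insert_subset hx.1 (hx.2.trans (erase_subset _ _)), mem_insert_self _ _⟩
  · rintro ⟨O, a⟩ hx
    simp only [mem_sigma, mem_powerset] at hx ⊢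
    exact ⟨hx.1 hx.2, erase_subset_erase _ hx.1⟩
  · rintro ⟨a, O⟩ hx
    simp only [mem_sigma, mem_powerset] at hx
    simp only [erase_insert fun h => notMem_erase a s (hx.2 h)]
  · rintro ⟨O, a⟩ hx
    simp only [mem_sigma, mem_powerset] at hx
    simp only [insert_erase hx.2]
  · rintro ⟨a, O⟩ hx
    simp only [mem_sigma, mem_powerset] at hx
    simp only [erase_insert fun h => notMem_erase a s (hx.2 h)]

/-- The sum of `f π.edges O` over the set partitions `π` of `[n]` and the sets `O` of greatest
elements of blocks of `π`. -/
def markedSum {M : Type*} [AddCommMonoid M] (n : ℕ) (f : Finset (ℕ × ℕ) → Finset ℕ → M) : M :=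
  ∑ π : SetPartition n, ∑ O ∈ π.tails.powerset, f π.edges O

/-- The four terms: `n + 1` is a closed singleton, opens a block, closes one, or is a transient of
one that stays open. If `n + 1` is joined to `a`, then `a` is no longer a tail; adding it back to
the marks turns this into completing the half-arc at `a`. -/
theorem markedSum_succ {M : Type*} [AddCommMonoid M] (n : ℕ)
    (f : Finset (ℕ × ℕ) → Finset ℕ → M) :
    markedSum (n + 1) f = markedSum n fun E O => f E O + f E (insert (n + 1) O) +
      ∑ a ∈ O, (f (insert (a, n + 1) E) (O.erase a) +
        f (insert (a, n + 1) E) (insert (n + 1) (O.erase a))) := by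
  unfold markedSum
  -- The tails depend on the partition only through its edges, so the inner sum is a function of the
  -- edge set.
  have h := SetPartition.sum_edges_succ (n := n)
    fun E => ∑ O ∈ (Icc 1 (n + 1) \ E.image Prod.fst).powerset, f E O
  rw [show ∑ π : SetPartition (n + 1), ∑ O ∈ π.tails.powerset, f π.edges O = _ from h]
  refine sum_congr rfl fun π _ => ?_
  have hlt := π.lt_and_le_of_mem_edges
  have hn : n + 1 ∉ π.tails := fun h => by
    have := mem_Icc.1 (mem_sdiff.1 h).1
    omega
  have h1 : Icc 1 (n + 1) \ π.edges.image Prod.fst = insert (n + 1) π.tails := by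
    rw [Icc_one_succ, insert_sdiff_of_notMem, SetPartition.tails]
    simp only [mem_image, not_exists, not_and]
    exact fun e he h => by have := hlt e he; omega
  have h2 : ∀ a ∈ π.tails, Icc 1 (n + 1) \ (insert (a, n + 1) π.edges).image Prod.fst =
      insert (n + 1) (π.tails.erase a) := by
    intro a ha
    rw [image_insert, sdiff_insert, h1, erase_insert_of_ne]
    rintro rfl
    exact hn ha
  rw [h1, sum_powerset_insert hn, sum_add_distrib, sum_add_distrib]
  congr 1
  rw [← sum_powerset_sum_erase π.tails fun a O =>
    f (insert (a, n + 1) π.edges) O + f (insert (a, n + 1) π.edges) (insert (n + 1) O)]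
  refine sum_congr rfl fun a ha => ?_
  rw [h2 a ha, sum_powerset_insert (fun h => hn (mem_of_mem_erase h)), sum_add_distrib]

/-! ### The recurrence for partitions with `k` open blocks -/

section Moments

variable {R : Type*} [CommRing R] (p q u₁ u₂ v : R)

/-- The generating polynomial of set partitions of `[n]` with `k` blocks marked as open. -/
def openBellPoly (n k : ℕ) : R :=
  markedSum n fun E O => if #O = k then arcWeight p q u₁ u₂ v n E O else 0

theorem openBellPoly_zero_right (n : ℕ) :
    openBellPoly p q u₁ u₂ v n 0 = bellPoly p q u₁ u₂ v n := by
  rw [openBellPoly, markedSum, bellPoly]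
  refine sum_congr rfl fun π _ => ?_
  rw [π.weight_eq_arcWeight, sum_eq_single ∅ (fun O _ hO => if_neg (by simpa using hO))
    (fun h => absurd (empty_mem_powerset _) h)]
  simp

theorem openBellPoly_zero_left (k : ℕ) :
    openBellPoly p q u₁ u₂ v 0 k = if k = 0 then 1 else 0 := by
  rcases k with _ | k
  · rw [openBellPoly_zero_right, bellPoly]
    have hd (π : SetPartition 0) : π.edges = ∅ := by
      simp [SetPartition.edges]
    simp_rw [SetPartition.weight_eq_arcWeight, hd]
    have : Unique (SetPartition 0) := inferInstanceAs (Unique (Finpartition (⊥ : Finset ℕ)))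
    rw [Fintype.sum_unique]
    simp [arcWeight, arcCr, arcNe, halfCr, halfNe, rightEnds]
  · rw [openBellPoly, markedSum, if_neg k.succ_ne_zero]
    refine sum_eq_zero fun π _ => sum_eq_zero fun O hO => if_neg ?_
    have : O = ∅ := by simpa [SetPartition.tails] using hO
    simp [this]

/-- The opening term keeps the condition `#O + 1 = k`, which is void for `k = 0` and gives height `k
- 1` otherwise, so one identity covers both forms of the Motzkin recurrence. -/
theorem openBellPoly_succ (n k : ℕ) :
    openBellPoly p q u₁ u₂ v (n + 1) k =
      (markedSum n fun E O => if #O + 1 = k then arcWeight p q u₁ u₂ v n E O else 0)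
      + (u₁ + pqNumber p q k * v) * openBellPoly p q u₁ u₂ v n k
      + u₂ * pqNumber p q (k + 1) * openBellPoly p q u₁ u₂ v n (k + 1) := by
  rw [openBellPoly, markedSum_succ, openBellPoly, openBellPoly]
  simp only [markedSum, mul_sum, ← sum_add_distrib]
  refine sum_congr rfl fun π _ => sum_congr rfl fun O hO => ?_
  have hE := π.lt_and_le_of_mem_edges
  have hO : ∀ o ∈ O, o ≤ n := fun o ho =>
    (mem_Icc.1 (mem_sdiff.1 (mem_powerset.1 hO ho)).1).2
  have hn : n + 1 ∉ O := fun h => by have := hO _ h; omega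
  have hsum : ∑ a ∈ O, ((if #(O.erase a) = k then
        arcWeight p q u₁ u₂ v (n + 1) (insert (a, n + 1) π.edges) (O.erase a) else 0) +
      (if #(insert (n + 1) (O.erase a)) = k then
        arcWeight p q u₁ u₂ v (n + 1) (insert (a, n + 1) π.edges) (insert (n + 1) (O.erase a))
        else 0)) =
      pqNumber p q #O * ((if #O = k + 1 then u₂ * arcWeight p q u₁ u₂ v n π.edges O else 0) +
        if #O = k then v * arcWeight p q u₁ u₂ v n π.edges O else 0) := by
    rw [← sum_pow_card_gt_mul_pow_card_lt, sum_mul]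
    refine sum_congr rfl fun a ha => ?_
    have hc := card_erase_add_one ha
    rw [card_insert_of_notMem (fun h => hn (mem_of_mem_erase h)), hc,
      arcWeight_close p q u₁ u₂ v hE hO ha, arcWeight_transient p q u₁ u₂ v hE hO ha]
    simp only [← hc, Nat.add_right_cancel_iff]
    split_ifs <;> ring
  rw [hsum, card_insert_of_notMem hn, arcWeight_singleton p q u₁ u₂ v hE hO,
    arcWeight_open p q u₁ u₂ v hE]
  -- For `#O = k` the singleton and transient terms survive, for `#O = k + 1` the closing term;
  -- otherwise only the opening term can, and it is the same on both sides.
  by_cases h1 : #O = k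
  · subst h1
    simp
    ring
  · by_cases h2 : #O = k + 1
    · rw [h2]
      simp [show k + 1 + 1 ≠ k by omega]
      ring
    · simp [h1, h2]

end Moments

theorem mainTheorem7 {R : Type*} [CommRing R] (p q u₁ u₂ v : R) :
    HasJFraction (PowerSeries.mk fun n => bellPoly p q u₁ u₂ v n)
      (fun k => u₁ + pqNumber p q k * v)
      (fun k => u₂ * pqNumber p q (k + 1)) := by
  simp_rw [← openBellPoly_zero_right p q u₁ u₂ v]
  refine hasJFraction_of_recurrence (openBellPoly_zero_left p q u₁ u₂ v) (fun n => ?_)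
    fun n k => ?_
  · rw [openBellPoly_succ]
    simp [markedSum]
  · rw [openBellPoly_succ]
    simp [openBellPoly]
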